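/- Let $\mathcal H$ be a real Hilbert space with norm $\|\cdot\|$, let $M_1,\ldots,M_m$ be closed linear subspaces of $\mathcal H$, and put $M:=\bigcap_{i=1}^m M_i$. Write $P_K$ for the orthogonal projection onto a closed linear subspace $K$, $K^\perp$ for its orthogonal complement, and $d(x,K)$ for the distance from $x$ to $K$. For $y_0\in\mathcal H$ let $y_k:=(P_{M_m}\cdots P_{M_1})^k(y_0)$, $k=1,2,\ldots$, be the sequence of the method of cyclic projections. Let $\sum_{i=1}^m M_i^\perp$ denote the (algebraic) sum of the subspaces $M_i^\perp$ and put $Y:=M\oplus\sum_{i=1}^m M_i^\perp$. Assume that $\sum_{i=1}^m M_i^\perp$ is not closed. Then there is a dense subset $U$ of $\mathcal H$ such that for each $y_0\in U$ and each $\varepsilon>0$, $$\limsup_{k\to\infty} k^{1+\varepsilon}\|y_k-y_{k-1}\|=\infty \quad\text{and}\quad \limsup_{k\to\infty} k^{1/2+\varepsilon}\sqrt{\frac1m\sum_{i=1}^m d^2(y_k,M_i)}=\infty .$$ Moreover, there is a dense subset $V$ of $Y$ such that for each $y_0\in V$ and each $\varepsilon>0$, $$\limsup_{k\to\infty} k^{1/2+\varepsilon}\|y_k-P_M(y_0)\|=\infty,\qquad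 \limsup_{k\to\infty} k^{3/2+\varepsilon}\|y_k-y_{k-1}\|=\infty$$ and $$\limsup_{k\to\infty} k^{1+\varepsilon}\sqrt{\frac1m\sum_{i=1}^m d^2(y_k,M_i)}=\infty .$$ -/

import Mathlib

open Filter Topology

noncomputable section

namespace CyclicProjections

variable {H : Type*} [NormedAddCommGroup H] [InnerProductSpace ℝ H]

/-- The algebraic sum `M₁ᗮ + ⋯ + Mₘᗮ`. The supremum is taken in the lattice of all linear subspaces,
so no closure is involved. -/
def sumOrthogonal {m : ℕ} (M : Fin m → ClosedSubmodule ℝ H) : Submodule ℝ H :=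
  ⨆ i, ((M i).toSubmodule)ᗮ

/-- The intersection `M₁ ∩ ⋯ ∩ Mₘ`, a closed linear subspace. -/
def inter {m : ℕ} (M : Fin m → ClosedSubmodule ℝ H) : ClosedSubmodule ℝ H :=
  ⨅ i, M i

/-- The linear subspace `Y = M ⊕ (M₁ᗮ + ⋯ + Mₘᗮ)` where `M = M₁ ∩ ⋯ ∩ Mₘ`. -/
def subspaceY {m : ℕ} (M : Fin m → ClosedSubmodule ℝ H) : Submodule ℝ H :=
  (inter M).toSubmodule ⊔ sumOrthogonal M

/-- The average distance `√((1/m) ∑ᵢ d(y, Mᵢ)²)`. -/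
def avgDist {m : ℕ} (M : Fin m → ClosedSubmodule ℝ H) (y : H) : ℝ :=
  √((1 / (m : ℝ)) * ∑ i, Metric.infDist y (M i : Set H) ^ 2)

variable [CompleteSpace H]

/-- The orthogonal projection onto a closed linear subspace, as an operator on `H`. -/
def proj (K : ClosedSubmodule ℝ H) : H →L[ℝ] H :=
  K.toSubmodule.starProjection

/-- The product `T = P_{Mₘ} ⋯ P_{M₁}` (the projection onto `M₁` acts first). -/
def cyclicOp {m : ℕ} (M : Fin m → ClosedSubmodule ℝ H) : H →L[ℝ] H :=
  (List.ofFn fun i => proj (M i)).reverse.prod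

/-- The trajectory `y_k = T^k y₀` of the method of cyclic projections. -/
def traj {m : ℕ} (M : Fin m → ClosedSubmodule ℝ H) (y₀ : H) (k : ℕ) : H :=
  (cyclicOp M ^ k) y₀

/-- `limsup_{k → ∞} k^p a_k = ∞`, the limit superior being taken in the extended reals. -/
def LimsupInfinite (p : ℝ) (a : ℕ → ℝ) : Prop :=
  limsup (fun k : ℕ => (((k : ℝ) ^ p * a k : ℝ) : EReal)) atTop = ⊤

end CyclicProjections

end

open Filter Topology

/-! Write T for the cyclic product. If `‖T^k - P_M‖ < 1` for one k, inverting `1 - (T^k - P_M)`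
shows that the sum of the `M_i^⊥` equals `M^⊥`, hence is closed. So here these norms stay at least
1, and by Banach–Steinhaus no rate `k^(-ε)` holds for all starting points; a Baire argument yields
one dense set of bad points for all ε.

The other quantities control the error `T^k y - P_M y`. Displacements `O(k^(-(1+p)))` telescope to
an error `O(k^(-p))`. One cycle lowers the squared error by at most a constant times the squared
residual, so average distances `O(k^(-(1/2+p)))` also give `O(k^(-p))`.

On Y the extra 1/2 comes from duality. A rate `k^(-(1/2+ε))` throughout Y bounds `‖T^k (1 -
P_{M_i})‖`, hence the adjoints `(1 - P_{M_i}) (T*)^k`. As T* is the cyclic product in reverse order,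
its residuals have that rate, so its errors are `O(k^(-ε))` everywhere: a contradiction. -/

namespace CyclicProjections

/-! ### Calculus of polynomial rates -/

/-- `a k = O(k^(-p))`, as a one-sided bound with a nonnegative constant. -/
def PolyBdd (p : ℝ) (a : ℕ → ℝ) : Prop :=
  ∃ C : ℝ, 0 ≤ C ∧ ∀ᶠ k : ℕ in atTop, a k ≤ C * (k : ℝ) ^ (-p)

theorem polyBdd_of_not_limsupInfinite {p : ℝ} {a : ℕ → ℝ} (h : ¬ LimsupInfinite p a) :
    PolyBdd p a := by
  unfold LimsupInfinite at h
  obtain ⟨c, hc, -⟩ := EReal.lt_iff_exists_real_btwn.1 (lt_top_iff_ne_top.2 h)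
  refine ⟨max c 0, le_max_right _ _, ?_⟩
  filter_upwards [eventually_lt_of_limsup_lt hc, eventually_gt_atTop 0] with k hk hk0
  have hk' : (k : ℝ) ^ p * a k < c := by exact_mod_cast hk
  have h0 : (0 : ℝ) < k := by exact_mod_cast hk0
  have hpos := Real.rpow_pos_of_pos h0 p
  rw [Real.rpow_neg h0.le, ← div_eq_mul_inv, le_div_iff₀ hpos, mul_comm]
  exact hk'.le.trans (le_max_left _ _)

theorem PolyBdd.mono {p : ℝ} {a b : ℕ → ℝ} (ha : PolyBdd p a) (h : ∀ᶠ k in atTop, b k ≤ a k) :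
    PolyBdd p b := by
  obtain ⟨C, hC, hev⟩ := ha
  exact ⟨C, hC, by filter_upwards [h, hev] with k h1 h2 using h1.trans h2⟩

theorem PolyBdd.weaken {p q : ℝ} {a : ℕ → ℝ} (ha : PolyBdd p a) (h : q ≤ p) : PolyBdd q a := by
  obtain ⟨C, hC, hev⟩ := ha
  refine ⟨C, hC, ?_⟩
  filter_upwards [hev, eventually_ge_atTop 1] with k h1 h2
  have h2' : (1 : ℝ) ≤ k := by exact_mod_cast h2
  exact h1.trans (mul_le_mul_of_nonneg_left
    (Real.rpow_le_rpow_of_exponent_le h2' (by linarith)) hC)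

theorem PolyBdd.add {p : ℝ} {a b : ℕ → ℝ} (ha : PolyBdd p a) (hb : PolyBdd p b) :
    PolyBdd p (fun k => a k + b k) := by
  obtain ⟨C, hC, hev⟩ := ha
  obtain ⟨D, hD, hev'⟩ := hb
  refine ⟨C + D, by positivity, ?_⟩
  filter_upwards [hev, hev'] with k h1 h2
  linarith

theorem PolyBdd.const_mul {p c : ℝ} (hc : 0 ≤ c) {a : ℕ → ℝ} (ha : PolyBdd p a) :
    PolyBdd p (fun k => c * a k) := by
  obtain ⟨C, hC, hev⟩ := ha
  refine ⟨c * C, by positivity, ?_⟩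
  filter_upwards [hev] with k h1
  rw [mul_assoc]
  exact mul_le_mul_of_nonneg_left h1 hc

theorem polyBdd_zero (p : ℝ) : PolyBdd p (fun _ => 0) :=
  ⟨0, le_rfl, by simp⟩

theorem PolyBdd.sum {ι : Type*} {p : ℝ} {a : ι → ℕ → ℝ} (s : Finset ι)
    (ha : ∀ i, PolyBdd p (a i)) : PolyBdd p (fun k => ∑ i ∈ s, a i k) := by
  classical
  induction s using Finset.induction_on with
  | empty => simpa using polyBdd_zero p
  | insert i s hi ih =>
    simp only [Finset.sum_insert hi]
    exact (ha i).add ih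

theorem PolyBdd.sq {p : ℝ} {a : ℕ → ℝ} (h0 : ∀ k, 0 ≤ a k) (ha : PolyBdd p a) :
    PolyBdd (2 * p) (fun k => a k ^ 2) := by
  obtain ⟨C, hC, hev⟩ := ha
  refine ⟨C ^ 2, by positivity, ?_⟩
  filter_upwards [hev] with k h1
  have : (k : ℝ) ^ (-(2 * p)) = ((k : ℝ) ^ (-p)) ^ 2 := by
    rw [← Real.rpow_natCast, ← Real.rpow_mul (Nat.cast_nonneg k)]
    congr 1
    push_cast
    ring
  rw [this, ← mul_pow]
  exact pow_le_pow_left₀ (h0 k) h1 2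

theorem PolyBdd.of_sq {p : ℝ} {a : ℕ → ℝ} (ha : PolyBdd (2 * p) (fun k => a k ^ 2)) :
    PolyBdd p a := by
  obtain ⟨C, hC, hev⟩ := ha
  refine ⟨√C, by positivity, ?_⟩
  filter_upwards [hev] with k h1
  have : (k : ℝ) ^ (-(2 * p)) = ((k : ℝ) ^ (-p)) ^ 2 := by
    rw [← Real.rpow_natCast, ← Real.rpow_mul (Nat.cast_nonneg k)]
    congr 1
    push_cast
    ring
  rw [this] at h1
  refine le_of_sq_le_sq ?_ (by positivity)
  rw [mul_pow, Real.sq_sqrt hC]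
  exact h1
where
  le_of_sq_le_sq {x y : ℝ} (h : x ^ 2 ≤ y ^ 2) (hy : 0 ≤ y) : x ≤ y :=
    (le_abs_self x).trans (abs_le_of_sq_le_sq h hy)

theorem PolyBdd.tendsto_zero {p : ℝ} (hp : 0 < p) {a : ℕ → ℝ} (h0 : ∀ k, 0 ≤ a k)
    (ha : PolyBdd p a) : Tendsto a atTop (𝓝 0) := by
  obtain ⟨C, hC, hev⟩ := ha
  have h := ((tendsto_rpow_neg_atTop hp).comp tendsto_natCast_atTop_atTop).const_mul C
  rw [mul_zero] at h
  exact squeeze_zero' (Eventually.of_forall h0) hev h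

/-- Multiply `(k/(k+1))^(-p) ≥ 1 + p/(k+1)`, a consequence of `log t ≤ t - 1`, by `(k+1)^(-p)`. -/
theorem mul_rpow_le_sub_rpow {p : ℝ} (hp : 0 < p) {k : ℝ} (hk : 1 ≤ k) :
    p * (k + 1) ^ (-(1 + p)) ≤ k ^ (-p) - (k + 1) ^ (-p) := by
  have hk0 : 0 < k := by linarith
  have hk1 : 0 < k + 1 := by linarith
  have h1 : 1 + p / (k + 1) ≤ (k / (k + 1)) ^ (-p) := by
    have hlog : Real.log (k / (k + 1)) ≤ k / (k + 1) - 1 :=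
      Real.log_le_sub_one_of_pos (by positivity)
    rw [Real.rpow_def_of_pos (by positivity)]
    have h2 : p / (k + 1) ≤ Real.log (k / (k + 1)) * (-p) := by
      have : k / (k + 1) - 1 = - (1 / (k + 1)) := by field_simp; ring
      rw [this] at hlog
      have := mul_le_mul_of_nonneg_left hlog hp.le
      rw [div_eq_mul_one_div]
      linarith
    linarith [Real.add_one_le_exp (Real.log (k / (k + 1)) * (-p))]
  have h3 : (k / (k + 1)) ^ (-p) * (k + 1) ^ (-p) = k ^ (-p) := by
    rw [← Real.mul_rpow (by positivity) hk1.le, div_mul_cancel₀ _ hk1.ne']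
  have h4 : (k + 1) ^ (-(1 + p)) = (k + 1) ^ (-p) / (k + 1) := by
    rw [show -(1 + p) = -p - 1 by ring, Real.rpow_sub_one hk1.ne']
  have h5 := mul_le_mul_of_nonneg_right h1 (Real.rpow_nonneg hk1.le (-p))
  rw [h3] at h5
  rw [h4]
  have : p * ((k + 1) ^ (-p) / (k + 1)) = p / (k + 1) * (k + 1) ^ (-p) := by ring
  linarith

/-- A null sequence whose decrements are `O(k^(-(1+p)))` is `O(k^(-p))`. -/
theorem PolyBdd.of_decrement {p : ℝ} (hp : 0 < p) {b : ℕ → ℝ} (hb : Tendsto b atTop (𝓝 0))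
    (h : PolyBdd (1 + p) (fun k => b k - b (k + 1))) : PolyBdd p b := by
  obtain ⟨C, hC, hev⟩ := h
  obtain ⟨N, hN⟩ := eventually_atTop.1 hev
  -- The factor `2^(1+p)` pays for `k + 1 ≤ 2k`. With this D, `b k - D k^(-p)` is eventually
  -- nondecreasing with limit 0, hence nonpositive.
  set D := C * 2 ^ (1 + p) / p with hD
  have hD0 : 0 ≤ D := by positivity
  refine ⟨D, hD0, eventually_atTop.2 ⟨max N 1, fun k hk => ?_⟩⟩
  have hstep : ∀ j, max N 1 ≤ j →
      b j - D * (j : ℝ) ^ (-p) ≤ b (j + 1) - D * ((j + 1 : ℕ) : ℝ) ^ (-p) := by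
    intro j hj
    have hj1 : (1 : ℝ) ≤ j := by exact_mod_cast (le_max_right N 1).trans hj
    have h1 := hN j ((le_max_left N 1).trans hj)
    have h2 := mul_le_mul_of_nonneg_left (mul_rpow_le_sub_rpow hp hj1) hD0
    have h3 : (j : ℝ) ^ (-(1 + p)) ≤ 2 ^ (1 + p) * ((j : ℝ) + 1) ^ (-(1 + p)) := by
      have h4 : (2 : ℝ) ^ (1 + p) = (2⁻¹ : ℝ) ^ (-(1 + p)) := by
        rw [Real.rpow_neg (by norm_num), Real.inv_rpow (by norm_num), inv_inv]
      rw [h4, ← Real.mul_rpow (by norm_num) (by positivity)]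
      exact Real.rpow_le_rpow_of_nonpos (by positivity) (by linarith) (by linarith)
    have h5 := mul_le_mul_of_nonneg_left h3 hC
    have h6 : D * (p * ((j : ℝ) + 1) ^ (-(1 + p))) =
        C * (2 ^ (1 + p) * ((j : ℝ) + 1) ^ (-(1 + p))) := by
      rw [hD]; field_simp
    push_cast
    linarith
  have hmono : ∀ n, b k - D * (k : ℝ) ^ (-p) ≤ b (k + n) - D * ((k + n : ℕ) : ℝ) ^ (-p) := by
    intro n
    induction n with
    | zero => simp
    | succ n ih => exact ih.trans (hstep (k + n) (hk.trans (Nat.le_add_right _ _)))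
  have hlim : Tendsto (fun j : ℕ => b j - D * (j : ℝ) ^ (-p)) atTop (𝓝 0) := by
    have h := hb.sub
      (((tendsto_rpow_neg_atTop hp).comp tendsto_natCast_atTop_atTop).const_mul D)
    simpa using h
  have hlim' : Tendsto (fun n : ℕ => b (k + n) - D * ((k + n : ℕ) : ℝ) ^ (-p)) atTop (𝓝 0) :=
    hlim.comp (tendsto_add_atTop_nat k |>.congr fun n => Nat.add_comm n k)
  linarith [ge_of_tendsto' hlim' hmono]

/-! ### Uniform boundedness and Baire category -/

section Condensation

variable {E F : Type*} [NormedAddCommGroup E] [NormedSpace ℝ E]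
  [NormedAddCommGroup F] [NormedSpace ℝ F]

/-- The subspace of points at which `‖A k x‖ = O(k^(-p))`. -/
def polyBddSubspace (p : ℝ) (A : ℕ → E →L[ℝ] F) : Submodule ℝ E where
  carrier := {x | PolyBdd p fun k => ‖A k x‖}
  zero_mem' := by simpa using polyBdd_zero p
  add_mem' {x y} hx hy := (PolyBdd.add hx hy).mono
    (Eventually.of_forall fun k => by rw [map_add]; exact norm_add_le _ _)
  smul_mem' c x hx := (PolyBdd.const_mul (norm_nonneg c) hx).mono
    (Eventually.of_forall fun k => by rw [map_smul, norm_smul])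

theorem polyBdd_opNorm [CompleteSpace E] {p : ℝ} {A : ℕ → E →L[ℝ] F}
    (h : ∀ x, PolyBdd p fun k => ‖A k x‖) : PolyBdd p fun k => ‖A k‖ := by
  have hbd : ∀ x, ∃ C, ∀ k : ℕ, ‖((k : ℝ) ^ p • A k) x‖ ≤ C := by
    intro x
    obtain ⟨C, hC, hev⟩ := h x
    have hev' : ∀ᶠ k : ℕ in atTop, ‖((k : ℝ) ^ p • A k) x‖ ≤ C := by
      filter_upwards [hev, eventually_gt_atTop 0] with k hk hk0
      have h0 : (0 : ℝ) < k := by exact_mod_cast hk0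
      rw [Real.rpow_neg h0.le, ← div_eq_mul_inv, le_div_iff₀ (Real.rpow_pos_of_pos h0 p)] at hk
      rw [smul_apply, norm_smul, Real.norm_of_nonneg (by positivity), mul_comm]
      exact hk
    obtain ⟨D, hD⟩ := (isBoundedUnder_of_eventually_le hev').bddAbove_range
    exact ⟨D, fun k => hD ⟨k, rfl⟩⟩
  obtain ⟨C, hC⟩ := banach_steinhaus hbd
  refine ⟨C, (norm_nonneg _).trans (hC 0), ?_⟩
  filter_upwards [eventually_gt_atTop 0] with k hk0
  have h0 : (0 : ℝ) < k := by exact_mod_cast hk0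
  have hk := hC k
  rw [norm_smul, Real.norm_of_nonneg (by positivity), mul_comm] at hk
  rw [Real.rpow_neg h0.le, ← div_eq_mul_inv, le_div_iff₀ (Real.rpow_pos_of_pos h0 p)]
  exact hk

/-- Condensation of singularities for polynomial rates. -/
theorem dense_not_polyBdd [CompleteSpace E] {p : ℝ} {A : ℕ → E →L[ℝ] F}
    (h : ∀ ε : ℝ, 0 < ε → ∃ x, ¬ PolyBdd (p + ε) fun k => ‖A k x‖) :
    Dense {x | ∀ ε : ℝ, 0 < ε → ¬ PolyBdd (p + ε) fun k => ‖A k x‖} := by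
  let q : ℕ → ℝ := fun n => p + 1 / ((n : ℝ) + 1)
  -- The first index selects an exponent; the second is both the constant and the threshold, so the
  -- family is countable.
  let B : ℕ × ℕ → Set E := fun j =>
    {x | ∀ k : ℕ, j.2 ≤ k → ‖A k x‖ ≤ j.2 * (k : ℝ) ^ (-q j.1)}
  have hclosed : ∀ j, IsClosed (B j) := by
    intro j
    simp only [B, Set.ofPred_forall]
    exact isClosed_iInter fun k => isClosed_iInter fun _ =>
      isClosed_le (A k).continuous.norm continuous_const
  have hsub : ∀ j, B j ⊆ polyBddSubspace (q j.1) A := fun j x hx =>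
    ⟨j.2, Nat.cast_nonneg _, eventually_atTop.2 ⟨j.2, hx⟩⟩
  -- A subspace with nonempty interior is the whole space, which would give every point the rate.
  have hint : ∀ j, interior (B j) = ∅ := by
    intro j
    rw [← Set.not_nonempty_iff_eq_empty]
    intro hne
    have htop := (polyBddSubspace (q j.1) A).eq_top_of_nonempty_interior'
      (hne.mono (interior_mono (hsub j)))
    obtain ⟨x, hx⟩ := h (1 / ((j.1 : ℝ) + 1)) (by positivity)
    exact hx (htop ▸ Submodule.mem_top : x ∈ polyBddSubspace (q j.1) A)
  have hdense : Dense (⋂ j, (B j)ᶜ) :=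
    dense_iInter_of_isOpen (fun j => (hclosed j).isOpen_compl)
      fun j => interior_eq_empty_iff_dense_compl.1 (hint j)
  refine hdense.mono fun x hx ε hε hbd => ?_
  obtain ⟨n, hn⟩ := exists_nat_one_div_lt hε
  obtain ⟨C, -, hev⟩ := hbd.weaken (q := q n) (by simp only [q]; linarith)
  obtain ⟨N, hN⟩ := eventually_atTop.1 hev
  obtain ⟨K, hK⟩ := exists_nat_ge C
  refine Set.mem_iInter.1 hx (n, max N K) fun k hk => (hN k ((le_max_left _ _).trans hk)).trans ?_
  refine mul_le_mul_of_nonneg_right (hK.trans ?_) (by positivity)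
  exact_mod_cast le_max_right N K

end Condensation

/-! ### Invariance under reversal of the order -/

section Families

variable {H : Type*} [NormedAddCommGroup H] [InnerProductSpace ℝ H] {m : ℕ}
  (M : Fin m → ClosedSubmodule ℝ H)

theorem mem_inter_iff {x : H} : x ∈ inter M ↔ ∀ i, x ∈ M i := by
  simp [inter]

theorem inter_rev : inter (fun i => M i.rev) = inter M :=
  Fin.revPerm.iInf_comp (g := M)

theorem sumOrthogonal_rev : sumOrthogonal (fun i => M i.rev) = sumOrthogonal M :=
  Fin.revPerm.iSup_comp (g := fun i => (M i).toSubmoduleᗮ)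

theorem sumOrthogonal_le : sumOrthogonal M ≤ (inter M).toSubmoduleᗮ :=
  iSup_le fun i => Submodule.orthogonal_le fun _ hx => (mem_inter_iff M).1 hx i

end Families

/-! ### Products of projections -/

variable {H : Type*} [NormedAddCommGroup H] [InnerProductSpace ℝ H] [CompleteSpace H]

theorem norm_sq_eq_proj (K : ClosedSubmodule ℝ H) (x : H) :
    ‖x‖ ^ 2 = ‖proj K x‖ ^ 2 + ‖x - proj K x‖ ^ 2 := by
  have h := K.toSubmodule.norm_sq_eq_add_norm_sq_starProjection x
  rwa [Submodule.starProjection_orthogonal_val] at h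

theorem norm_proj_le (K : ClosedSubmodule ℝ H) (x : H) : ‖proj K x‖ ≤ ‖x‖ :=
  K.toSubmodule.norm_starProjection_apply_le x

theorem norm_sub_proj_le (K : ClosedSubmodule ℝ H) (x : H) : ‖x - proj K x‖ ≤ ‖x‖ := by
  have := norm_sq_eq_proj K x
  exact (sq_le_sq₀ (norm_nonneg _) (norm_nonneg _)).1 (by nlinarith [sq_nonneg ‖proj K x‖])

theorem proj_eq_self_iff {K : ClosedSubmodule ℝ H} {x : H} : proj K x = x ↔ x ∈ K :=
  Submodule.starProjection_eq_self_iff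

theorem sub_proj_mem (K : ClosedSubmodule ℝ H) (x : H) : x - proj K x ∈ K.toSubmoduleᗮ :=
  Submodule.sub_starProjection_mem_orthogonal x

theorem infDist_eq_norm_sub_proj (K : ClosedSubmodule ℝ H) (x : H) :
    Metric.infDist x (K : Set H) = ‖x - proj K x‖ := by
  rw [proj, Submodule.starProjection_minimal, Metric.infDist_eq_iInf]
  simp only [dist_eq_norm]
  rfl

/-- The product of the projections onto the members of a list; the last one acts first. -/
noncomputable def prodProj (L : List (ClosedSubmodule ℝ H)) : H →L[ℝ] H := (L.map proj).prod

theorem prodProj_cons (K : ClosedSubmodule ℝ H) (L : List (ClosedSubmodule ℝ H)) (x : H) :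
    prodProj (K :: L) x = proj K (prodProj L x) := by
  simp [prodProj]

theorem norm_prodProj_le (L : List (ClosedSubmodule ℝ H)) (x : H) : ‖prodProj L x‖ ≤ ‖x‖ := by
  induction L with
  | nil => simp [prodProj]
  | cons K L ih => rw [prodProj_cons]; exact (norm_proj_le _ _).trans ih

theorem norm_sub_prodProj_le (L : List (ClosedSubmodule ℝ H)) (x : H) :
    ‖x - prodProj L x‖ ≤ (L.map fun K => ‖x - proj K x‖).sum := by
  induction L with
  | nil => simp [prodProj]
  | cons K L ih =>
    rw [prodProj_cons, List.map_cons, List.sum_cons]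
    calc ‖x - proj K (prodProj L x)‖
        = ‖(x - proj K x) + proj K (x - prodProj L x)‖ := by rw [map_sub]; congr 1; abel
      _ ≤ ‖x - proj K x‖ + ‖x - prodProj L x‖ :=
          (norm_add_le _ _).trans (add_le_add_right (norm_proj_le _ _) _)
      _ ≤ _ := add_le_add_right ih _

/-- By Pythagoras each factor loses the squared distance from the current point to its subspace.
That point is within the sum of the earlier distances of `x`. -/
theorem exists_energy_le (L : List (ClosedSubmodule ℝ H)) : ∃ C : ℝ, 0 ≤ C ∧ ∀ x,
    ‖x‖ ^ 2 - ‖prodProj L x‖ ^ 2 ≤ C * (L.map fun K => ‖x - proj K x‖).sum ^ 2 := by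
  induction L with
  | nil => exact ⟨0, le_rfl, by simp [prodProj]⟩
  | cons K L ih =>
    obtain ⟨C, hC, h⟩ := ih
    refine ⟨C + 1, by positivity, fun x => ?_⟩
    have hdisp := norm_sub_prodProj_le L x
    rw [prodProj_cons, List.map_cons, List.sum_cons]
    set s := (L.map fun K => ‖x - proj K x‖).sum
    have hs : 0 ≤ s := (norm_nonneg _).trans hdisp
    have h1 := norm_sq_eq_proj K (prodProj L x)
    have h2 : ‖prodProj L x - proj K (prodProj L x)‖ ≤ ‖x - proj K x‖ + s := by
      calc ‖prodProj L x - proj K (prodProj L x)‖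
          = ‖(x - proj K x) - ((x - prodProj L x) - proj K (x - prodProj L x))‖ := by
            rw [map_sub]; congr 1; abel
        _ ≤ ‖x - proj K x‖ + ‖x - prodProj L x‖ :=
            (norm_sub_le _ _).trans (add_le_add_right (norm_sub_proj_le _ _) _)
        _ ≤ _ := add_le_add_right hdisp _
    have h3 := pow_le_pow_left₀ (norm_nonneg _) h2 2
    have h4 : s ^ 2 ≤ (‖x - proj K x‖ + s) ^ 2 :=
      pow_le_pow_left₀ hs (by linarith [norm_nonneg (x - proj K x)]) 2
    have h5 := mul_le_mul_of_nonneg_left h4 hC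
    linarith [h x]

/-- Pythagoras at each factor, combined through `(a + b)^2 ≤ 2a^2 + 2b^2`. -/
theorem exists_displacement_sq_le (L : List (ClosedSubmodule ℝ H)) : ∃ C : ℝ, 0 ≤ C ∧ ∀ x,
    ‖x - prodProj L x‖ ^ 2 ≤ C * (‖x‖ ^ 2 - ‖prodProj L x‖ ^ 2) := by
  induction L with
  | nil => exact ⟨0, le_rfl, by simp [prodProj]⟩
  | cons K L ih =>
    obtain ⟨C, hC, h⟩ := ih
    refine ⟨2 * C + 2, by positivity, fun x => ?_⟩
    rw [prodProj_cons]
    have h1 := norm_sq_eq_proj K (prodProj L x)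
    have h2 := pow_le_pow_left₀ (norm_nonneg _)
      (norm_sub_le_norm_sub_add_norm_sub x (prodProj L x) (proj K (prodProj L x))) 2
    have h3 := pow_le_pow_left₀ (norm_nonneg _) (norm_prodProj_le L x) 2
    have h4 := h x
    have h5 := mul_nonneg hC (sq_nonneg ‖prodProj L x - proj K (prodProj L x)‖)
    nlinarith [sq_nonneg (‖x - prodProj L x‖ - ‖prodProj L x - proj K (prodProj L x)‖)]

theorem mem_of_norm_prodProj_eq (L : List (ClosedSubmodule ℝ H)) {x : H}
    (hx : ‖prodProj L x‖ = ‖x‖) : ∀ K ∈ L, x ∈ K := by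
  induction L with
  | nil => simp
  | cons K L ih =>
    rw [prodProj_cons] at hx
    have h1 : ‖prodProj L x‖ = ‖x‖ :=
      le_antisymm (norm_prodProj_le _ _) (hx ▸ norm_proj_le _ _)
    have h2 : prodProj L x = x := by
      obtain ⟨C, -, h⟩ := exists_displacement_sq_le L
      have h3 := h x
      rw [h1, sub_self, mul_zero] at h3
      have h4 : ‖x - prodProj L x‖ = 0 := by
        have := le_antisymm h3 (sq_nonneg _)
        exact pow_eq_zero_iff two_ne_zero |>.1 this
      exact (sub_eq_zero.1 (norm_eq_zero.1 h4)).symm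
    have h5 : x ∈ K := by
      rw [h2] at hx
      have h3 := norm_sq_eq_proj K x
      rw [hx] at h3
      have h4 : ‖x - proj K x‖ = 0 := pow_eq_zero_iff two_ne_zero |>.1 (by linarith)
      exact proj_eq_self_iff.1 (sub_eq_zero.1 (norm_eq_zero.1 h4)).symm
    intro K' hK'
    rcases List.mem_cons.1 hK' with rfl | h
    · exact h5
    · exact ih h1 K' h

theorem prodProj_eq_self {L : List (ClosedSubmodule ℝ H)} {x : H} (hx : ∀ K ∈ L, x ∈ K) :
    prodProj L x = x := by
  induction L with
  | nil => simp [prodProj]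
  | cons K L ih =>
    rw [prodProj_cons, ih fun K' h => hx K' (List.mem_cons_of_mem _ h)]
    exact proj_eq_self_iff.2 (hx K List.mem_cons_self)

theorem sub_prodProj_mem {L : List (ClosedSubmodule ℝ H)} {S : Submodule ℝ H}
    (hS : ∀ K ∈ L, K.toSubmoduleᗮ ≤ S) (x : H) : x - prodProj L x ∈ S := by
  induction L with
  | nil => simp [prodProj]
  | cons K L ih =>
    rw [prodProj_cons]
    have h1 := ih fun K' h => hS K' (List.mem_cons_of_mem _ h)
    have h2 := hS K List.mem_cons_self (sub_proj_mem K (prodProj L x))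
    simpa using S.add_mem h1 h2

/-! ### The cyclic operator and its adjoint -/

variable {m : ℕ} (M : Fin m → ClosedSubmodule ℝ H)

theorem cyclicOp_eq_prodProj : cyclicOp M = prodProj (List.ofFn M).reverse := by
  rw [cyclicOp, prodProj, List.map_reverse, List.map_ofFn]
  rfl

/-- The sum of the distances of `x` to the subspaces `M i`. -/
noncomputable def resid (x : H) : ℝ := ∑ i, ‖x - proj (M i) x‖

theorem resid_nonneg (x : H) : 0 ≤ resid M x := Finset.sum_nonneg fun _ _ => norm_nonneg _

theorem sum_map_reverse_ofFn (x : H) :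
    ((List.ofFn M).reverse.map fun K => ‖x - proj K x‖).sum = resid M x := by
  rw [List.map_reverse, List.sum_reverse, List.map_ofFn, List.sum_ofFn]
  rfl

theorem avgDist_le_resid (x : H) : avgDist M x ≤ resid M x := by
  rw [avgDist, Real.sqrt_le_left (resid_nonneg M x)]
  simp only [infDist_eq_norm_sub_proj]
  have h1 : ∑ i, ‖x - proj (M i) x‖ ^ 2 ≤ resid M x ^ 2 :=
    Finset.sum_sq_le_sq_sum_of_nonneg fun _ _ => norm_nonneg _
  have h2 : (1 / (m : ℝ)) ≤ 1 := by
    rcases Nat.eq_zero_or_pos m with rfl | hm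
    · simp
    · exact div_le_one_of_le₀ (by exact_mod_cast hm) (by positivity)
  have h3 : 0 ≤ ∑ i, ‖x - proj (M i) x‖ ^ 2 := Finset.sum_nonneg fun _ _ => sq_nonneg _
  nlinarith

theorem resid_le_mul_avgDist (x : H) : resid M x ≤ m * avgDist M x := by
  rcases Nat.eq_zero_or_pos m with rfl | hm
  · simp [resid]
  have hm' : (0 : ℝ) < m := by exact_mod_cast hm
  have h0 : 0 ≤ m * avgDist M x := by unfold avgDist; positivity
  refine (sq_le_sq₀ (resid_nonneg M x) h0).1 ?_
  have h1 : resid M x ^ 2 ≤ m * ∑ i, ‖x - proj (M i) x‖ ^ 2 := by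
    simpa [resid] using sq_sum_le_card_mul_sum_sq (s := Finset.univ) (f := fun i => ‖x - proj (M i) x‖)
  rw [mul_pow, avgDist, Real.sq_sqrt (by positivity)]
  simp only [infDist_eq_norm_sub_proj]
  refine h1.trans (le_of_eq ?_)
  field_simp

theorem norm_cyclicOp_apply_le (x : H) : ‖cyclicOp M x‖ ≤ ‖x‖ := by
  rw [cyclicOp_eq_prodProj]; exact norm_prodProj_le _ _

theorem cyclicOp_eq_self_iff {x : H} : cyclicOp M x = x ↔ x ∈ inter M := by
  rw [cyclicOp_eq_prodProj, mem_inter_iff]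
  constructor
  · intro h i
    exact mem_of_norm_prodProj_eq _ (congrArg _ h) (M i) (by simp)
  · intro h
    refine prodProj_eq_self fun K hK => ?_
    obtain ⟨i, rfl⟩ : ∃ i, M i = K := by simpa using hK
    exact h i

theorem exists_cyclicOp_energy_le : ∃ C : ℝ, 0 ≤ C ∧ ∀ x,
    ‖x‖ ^ 2 - ‖cyclicOp M x‖ ^ 2 ≤ C * resid M x ^ 2 := by
  simp only [cyclicOp_eq_prodProj, ← sum_map_reverse_ofFn]
  exact exists_energy_le _

theorem adjoint_prodProj (L : List (ClosedSubmodule ℝ H)) :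
    ContinuousLinearMap.adjoint (prodProj L) = prodProj L.reverse := by
  rw [← ContinuousLinearMap.star_eq_adjoint]
  induction L with
  | nil => simp [prodProj]
  | cons K L ih =>
    have hK : star (proj K) = proj K := isSelfAdjoint_starProjection K.toSubmodule
    simp only [prodProj, List.map_cons, List.prod_cons, List.reverse_cons, List.map_append,
      List.prod_append, List.map_nil, List.prod_nil, mul_one, star_mul, hK] at ih ⊢
    rw [ih]

theorem ofFn_comp_rev {α : Type*} {n : ℕ} (f : Fin n → α) :
    List.ofFn (fun i => f i.rev) = (List.ofFn f).reverse := by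
  apply List.ext_getElem
  · simp
  · intro k h1 h2
    simp only [List.getElem_ofFn, List.getElem_reverse, List.length_ofFn]
    congr 1
    ext
    simp [Fin.val_rev]
    omega

theorem adjoint_cyclicOp :
    ContinuousLinearMap.adjoint (cyclicOp M) = cyclicOp fun i => M i.rev := by
  rw [cyclicOp_eq_prodProj, cyclicOp_eq_prodProj, adjoint_prodProj, ofFn_comp_rev]

/-! ### Strong convergence -/

theorem traj_succ (y : H) (k : ℕ) : traj M y (k + 1) = cyclicOp M (traj M y k) := by
  rw [traj, traj, pow_succ']; rfl

theorem norm_cyclicOp_pow_apply_le (k : ℕ) (x : H) : ‖(cyclicOp M ^ k) x‖ ≤ ‖x‖ := by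
  induction k with
  | zero => simp
  | succ k ih =>
    rw [pow_succ']
    exact (norm_cyclicOp_apply_le M _).trans ih

theorem tendsto_traj_sub (x : H) :
    Tendsto (fun k => traj M x k - traj M x (k + 1)) atTop (𝓝 0) := by
  obtain ⟨C, -, h⟩ := exists_displacement_sq_le (List.ofFn M).reverse
  rw [← cyclicOp_eq_prodProj] at h
  have hanti : Antitone fun k => ‖traj M x k‖ ^ 2 := antitone_nat_of_succ_le fun k => by
    rw [traj_succ]
    exact pow_le_pow_left₀ (norm_nonneg _) (norm_cyclicOp_apply_le M _) 2
  have hlim := tendsto_atTop_ciInf hanti ⟨0, by rintro _ ⟨k, rfl⟩; positivity⟩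
  have h2 := (hlim.sub (hlim.comp (tendsto_add_atTop_nat 1))).const_mul C
  rw [sub_self, mul_zero] at h2
  have h3 : Tendsto (fun k => ‖traj M x k - traj M x (k + 1)‖ ^ 2) atTop (𝓝 0) := by
    refine squeeze_zero (fun _ => by positivity) (fun k => ?_) h2
    simpa [traj_succ] using h (traj M x k)
  rw [tendsto_zero_iff_norm_tendsto_zero]
  simpa [Real.sqrt_sq] using h3.sqrt

/-- The orthogonal complement of the range of `1 - T` is the kernel of `1 - T*`, and T* has the same
fixed points as T. -/
theorem orthogonal_inter_eq_closure :
    (inter M).toSubmoduleᗮ =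
      ((1 - cyclicOp M : H →L[ℝ] H).range).topologicalClosure := by
  rw [← Submodule.orthogonal_orthogonal_eq_closure, ContinuousLinearMap.orthogonal_range]
  congr 1
  ext x
  rw [LinearMap.mem_ker, map_sub, adjoint_cyclicOp]
  have h1 : ContinuousLinearMap.adjoint (1 : H →L[ℝ] H) = 1 := star_one _
  rw [h1]
  change x ∈ inter M ↔ x - cyclicOp (fun i => M i.rev) x = 0
  rw [← inter_rev, ← cyclicOp_eq_self_iff, sub_eq_zero, eq_comm]

theorem traj_sub_proj (y : H) (k : ℕ) :
    traj M y k - proj (inter M) y = (cyclicOp M ^ k) (y - proj (inter M) y) := by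
  have hfix : (cyclicOp M ^ k) (proj (inter M) y) = proj (inter M) y := by
    have h1 : cyclicOp M (proj (inter M) y) = proj (inter M) y :=
      (cyclicOp_eq_self_iff M).2 (Submodule.starProjection_apply_mem _ y)
    induction k with
    | zero => simp
    | succ k ih => rw [pow_succ, mul_apply_eq_comp, h1, ih]
  rw [map_sub, hfix]
  rfl

/-- Halperin's theorem: the method of cyclic projections converges strongly. -/
theorem tendsto_traj (y : H) :
    Tendsto (fun k => traj M y k - proj (inter M) y) atTop (𝓝 0) := by
  simp only [traj_sub_proj]
  have hw : y - proj (inter M) y ∈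
      ((1 - cyclicOp M : H →L[ℝ] H).range).topologicalClosure := by
    rw [← orthogonal_inter_eq_closure]; exact sub_proj_mem _ _
  generalize y - proj (inter M) y = w at hw
  rw [Metric.tendsto_atTop]
  intro ε hε
  -- On the range of `1 - T` the powers give consecutive differences, which tend to 0; contractivity
  -- extends this to the closure.
  obtain ⟨z, ⟨x, rfl⟩, hz⟩ := Metric.mem_closure_iff.1 hw (ε / 2) (by positivity)
  obtain ⟨N, hN⟩ := Metric.tendsto_atTop.1 (tendsto_traj_sub M x) (ε / 2) (by positivity)
  refine ⟨N, fun k hk => ?_⟩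
  have h1 := hN k hk
  rw [dist_zero_right] at h1 ⊢
  rw [dist_eq_norm] at hz
  set z : H := (1 - cyclicOp M : H →L[ℝ] H) x with hzdef
  have h2 : (cyclicOp M ^ k) z = traj M x k - traj M x (k + 1) := by
    rw [hzdef, traj, traj, pow_succ]
    simp
  rw [← h2] at h1
  calc ‖(cyclicOp M ^ k) w‖ = ‖(cyclicOp M ^ k) (w - z) + (cyclicOp M ^ k) z‖ := by
        rw [map_sub]; congr 1; abel
    _ ≤ ‖w - z‖ + ‖(cyclicOp M ^ k) z‖ :=
        (norm_add_le _ _).trans (add_le_add_left (norm_cyclicOp_pow_apply_le M k _) _)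
    _ < ε := by
        have hz' : ‖w - z‖ < ε / 2 := hz
        linarith

/-! ### Closedness of the sum and transfer of rates -/

theorem sub_cyclicOp_pow_mem (k : ℕ) (x : H) : x - (cyclicOp M ^ k) x ∈ sumOrthogonal M := by
  induction k with
  | zero => simp
  | succ k ih =>
    have h : (cyclicOp M ^ k) x - cyclicOp M ((cyclicOp M ^ k) x) ∈ sumOrthogonal M := by
      rw [cyclicOp_eq_prodProj]
      refine sub_prodProj_mem (fun K hK => ?_) _
      obtain ⟨i, rfl⟩ : ∃ i, M i = K := by simpa using hK
      exact le_iSup (fun i => (M i).toSubmoduleᗮ) i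
    rw [pow_succ']
    simpa using Submodule.add_mem _ ih h

theorem isClosed_sumOrthogonal_of_norm_lt {k : ℕ}
    (h : ‖cyclicOp M ^ k - proj (inter M)‖ < 1) : IsClosed (sumOrthogonal M : Set H) := by
  have heq : sumOrthogonal M = (inter M).toSubmoduleᗮ := by
    refine le_antisymm (sumOrthogonal_le M) fun x hx => ?_
    obtain ⟨u, hu⟩ := isUnit_one_sub_of_norm_lt_one h
    obtain ⟨z, hz⟩ : ∃ z, (1 - (cyclicOp M ^ k - proj (inter M)) : H →L[ℝ] H) z = x := by
      refine ⟨(↑u⁻¹ : H →L[ℝ] H) x, ?_⟩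
      rw [← hu, ← mul_apply_eq_comp, Units.mul_inv]
      rfl
    have h1 := sub_cyclicOp_pow_mem M k z
    have h2 : x - (z - (cyclicOp M ^ k) z) = proj (inter M) z := by
      rw [← hz]; simp
    -- Here `x = (z - T^k z) + P_M z`, with `x` and the bracket orthogonal to M, so `P_M z`
    -- vanishes.
    have h3 : proj (inter M) z ∈ (inter M).toSubmodule := Submodule.starProjection_apply_mem _ z
    have h4 : proj (inter M) z ∈ (inter M).toSubmoduleᗮ := by
      rw [← h2]; exact Submodule.sub_mem _ hx (sumOrthogonal_le M h1)
    have h5 : proj (inter M) z = 0 := inner_self_eq_zero.1 (h4 _ h3)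
    rw [h5, sub_eq_zero] at h2
    rwa [h2]
  rw [heq]
  exact Submodule.isClosed_orthogonal _

theorem PolyBdd.traj_of_displacement {p : ℝ} (hp : 0 < p) {y : H}
    (h : PolyBdd (1 + p) fun k => ‖traj M y k - traj M y (k - 1)‖) :
    PolyBdd p fun k => ‖traj M y k - proj (inter M) y‖ := by
  refine PolyBdd.of_decrement hp (by simpa using (tendsto_traj M y).norm) ?_
  obtain ⟨C, hC, hev⟩ := h
  refine ⟨C, hC, ?_⟩
  filter_upwards [(tendsto_add_atTop_nat 1).eventually hev, eventually_gt_atTop 0] with k hk hk0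
  have h0 : (0 : ℝ) < k := by exact_mod_cast hk0
  rw [Nat.add_sub_cancel] at hk
  have h1 : ((k + 1 : ℕ) : ℝ) ^ (-(1 + p)) ≤ (k : ℝ) ^ (-(1 + p)) :=
    Real.rpow_le_rpow_of_nonpos h0 (by push_cast; linarith) (by linarith)
  have h2 := norm_sub_norm_le (traj M y k - proj (inter M) y) (traj M y (k + 1) - proj (inter M) y)
  rw [sub_sub_sub_cancel_right, norm_sub_rev (traj M y k) (traj M y (k + 1))] at h2
  exact h2.trans (hk.trans (mul_le_mul_of_nonneg_left h1 hC))

theorem PolyBdd.traj_of_avgDist {p : ℝ} (hp : 0 < p) {y : H}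
    (h : PolyBdd (1 / 2 + p) fun k => avgDist M (traj M y k)) :
    PolyBdd p fun k => ‖traj M y k - proj (inter M) y‖ := by
  obtain ⟨C, hC, hen⟩ := exists_cyclicOp_energy_le M
  refine PolyBdd.of_sq (PolyBdd.of_decrement (by positivity)
    (by simpa using (tendsto_traj M y).norm.pow 2) ?_)
  have h1 := (((h.const_mul (Nat.cast_nonneg m)).mono
    (Eventually.of_forall fun k => resid_le_mul_avgDist M _)).sq
      fun k => resid_nonneg M _).const_mul hC
  rw [show 2 * (1 / 2 + p) = 1 + 2 * p by ring] at h1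
  refine h1.mono (Eventually.of_forall fun k => ?_)
  have hmem : ∀ i, proj (M i) (proj (inter M) y) = proj (inter M) y := fun i =>
    proj_eq_self_iff.2 ((mem_inter_iff M).1 (Submodule.starProjection_apply_mem _ y) i)
  -- Subtracting `P_M y`, a common fixed point of all projections, leaves the residuals unchanged.
  have h2 := hen (traj M y k - proj (inter M) y)
  have h3 : resid M (traj M y k - proj (inter M) y) = resid M (traj M y k) := by
    refine Finset.sum_congr rfl fun i _ => ?_
    rw [map_sub, hmem, sub_sub_sub_cancel_right]
  have h4 : cyclicOp M (traj M y k - proj (inter M) y) = traj M y (k + 1) - proj (inter M) y := by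
    rw [map_sub, traj_succ,
      (cyclicOp_eq_self_iff M (x := proj (inter M) y)).2 (Submodule.starProjection_apply_mem _ y)]
  rwa [h3, h4] at h2

theorem exists_not_polyBdd (hM : ¬ IsClosed (sumOrthogonal M : Set H)) {ε : ℝ} (hε : 0 < ε) :
    ∃ y, ¬ PolyBdd ε fun k => ‖(cyclicOp M ^ k - proj (inter M)) y‖ := by
  by_contra! h
  have h1 := (polyBdd_opNorm h).tendsto_zero hε fun _ => norm_nonneg _
  obtain ⟨k, hk⟩ := (h1.eventually (gt_mem_nhds one_pos)).exists
  exact hM (isClosed_sumOrthogonal_of_norm_lt M hk)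

/-! ### Starting points in Y -/

/-- A parametrization of the subspace `Y` by a Banach space. -/
noncomputable def paramY : H × (Fin m → H) →L[ℝ] H :=
  (proj (inter M)).comp (ContinuousLinearMap.fst ℝ H (Fin m → H)) +
    ∑ i, (1 - proj (M i)).comp
      ((ContinuousLinearMap.proj i).comp (ContinuousLinearMap.snd ℝ H (Fin m → H)))

theorem paramY_apply (z : H × (Fin m → H)) :
    paramY M z = proj (inter M) z.1 + ∑ i, (z.2 i - proj (M i) (z.2 i)) := by
  simp [paramY]

theorem paramY_mem (z : H × (Fin m → H)) : paramY M z ∈ subspaceY M := by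
  rw [paramY_apply]
  refine Submodule.add_mem_sup (Submodule.starProjection_apply_mem _ _)
    (Submodule.sum_mem _ fun i _ => ?_)
  exact Submodule.mem_iSup_of_mem i (sub_proj_mem _ _)

theorem exists_paramY_eq {y : H} (hy : y ∈ subspaceY M) : ∃ z, paramY M z = y := by
  obtain ⟨a, ha, b, hb, rfl⟩ := Submodule.mem_sup.1 hy
  obtain ⟨f, hf, rfl⟩ := (Submodule.mem_iSup_iff_exists_finsupp _ _).1 hb
  refine ⟨(a, f), ?_⟩
  rw [paramY_apply, proj_eq_self_iff.2 ha, Finsupp.sum_fintype _ _ fun _ => rfl]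
  congr 1
  refine Finset.sum_congr rfl fun i _ => ?_
  have h : proj (M i) (f i) = 0 := (Submodule.starProjection_apply_eq_zero_iff _).2 (hf i)
  rw [h, sub_zero]

theorem cyclicOp_pow_sub_proj_apply (y : H) (k : ℕ) :
    (cyclicOp M ^ k - proj (inter M)) y = traj M y k - proj (inter M) y := rfl

theorem exists_not_polyBdd_paramY (hM : ¬ IsClosed (sumOrthogonal M : Set H)) {ε : ℝ}
    (hε : 0 < ε) : ∃ z, ¬ PolyBdd (1 / 2 + ε)
      fun k => ‖((cyclicOp M ^ k - proj (inter M)).comp (paramY M)) z‖ := by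
  by_contra! h
  -- Feeding only the i-th coordinate turns the rate on Y into a pointwise rate for `T^k (1 -
  -- P_{M_i})` on all of H.
  have hop : ∀ i, PolyBdd (1 / 2 + ε) fun k => ‖cyclicOp M ^ k * (1 - proj (M i))‖ := by
    refine fun i => polyBdd_opNorm fun x => (h (0, Pi.single i x)).mono
      (Eventually.of_forall fun k => le_of_eq ?_)
    have h1 : paramY M (0, Pi.single i x) = x - proj (M i) x := by
      rw [paramY_apply, Finset.sum_eq_single i]
      · simp
      · intro j _ hj
        simp [Pi.single_eq_of_ne hj]
      · simp
    have h2 : proj (inter M) (x - proj (M i) x) = 0 :=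
      (Submodule.starProjection_apply_eq_zero_iff _).2
        (sumOrthogonal_le M (Submodule.mem_iSup_of_mem i (sub_proj_mem _ _)))
    rw [ContinuousLinearMap.comp_apply, h1, sub_apply, h2, sub_zero]
    rfl
  obtain ⟨y, hy⟩ := exists_not_polyBdd (fun i => M i.rev) (by rwa [sumOrthogonal_rev]) hε
  simp only [cyclicOp_pow_sub_proj_apply] at hy
  refine hy (PolyBdd.traj_of_avgDist _ hε (PolyBdd.mono ?_
    (Eventually.of_forall fun k => avgDist_le_resid _ _)))
  refine PolyBdd.sum _ fun i => ((hop i.rev).const_mul (norm_nonneg y)).mono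
    (Eventually.of_forall fun k => ?_)
  have hadj : ContinuousLinearMap.adjoint (cyclicOp M ^ k * (1 - proj (M i.rev))) =
      (1 - proj (M i.rev)) * cyclicOp (fun i => M i.rev) ^ k := by
    have hK : star (proj (M i.rev)) = proj (M i.rev) :=
      isSelfAdjoint_starProjection (M i.rev).toSubmodule
    rw [← adjoint_cyclicOp, ← ContinuousLinearMap.star_eq_adjoint,
      ← ContinuousLinearMap.star_eq_adjoint, star_mul, star_pow, star_sub, star_one, hK]
  rw [← (ContinuousLinearMap.adjoint).norm_map (cyclicOp M ^ k * (1 - proj (M i.rev))), hadj,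
    mul_comm]
  exact ((1 - proj (M i.rev)) * cyclicOp (fun i => M i.rev) ^ k).le_opNorm y

/-- Y need not be complete, so Baire is applied on the parameter space and density is carried over
by the continuous surjection. -/
theorem dense_image_paramY {D : Set (H × (Fin m → H))} (hD : Dense D) :
    Dense {y : subspaceY M | ∃ z ∈ D, paramY M z = y} := by
  let f : H × (Fin m → H) → subspaceY M := fun z => ⟨paramY M z, paramY_mem M z⟩
  have hf : Continuous f := (paramY M).continuous.subtype_mk _
  have hsurj : Function.Surjective f := fun y => by
    obtain ⟨z, hz⟩ := exists_paramY_eq M y.2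
    exact ⟨z, Subtype.ext hz⟩
  refine (hsurj.denseRange.dense_image hf hD).mono ?_
  rintro _ ⟨z, hz, rfl⟩
  exact ⟨z, hz, rfl⟩

end CyclicProjections

open CyclicProjections in
theorem theorem4p5 {H : Type*} [NormedAddCommGroup H] [InnerProductSpace ℝ H] [CompleteSpace H]
    {m : ℕ} (M : Fin m → ClosedSubmodule ℝ H)
    (hM : ¬ IsClosed (CyclicProjections.sumOrthogonal M : Set H)) :
    (∃ U : Set H, Dense U ∧ ∀ y₀ ∈ U, ∀ ε : ℝ, 0 < ε →
      CyclicProjections.LimsupInfinite (1 + ε)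
        (fun k => ‖CyclicProjections.traj M y₀ k - CyclicProjections.traj M y₀ (k - 1)‖) ∧
      CyclicProjections.LimsupInfinite (1 / 2 + ε)
        (fun k => CyclicProjections.avgDist M (CyclicProjections.traj M y₀ k))) ∧
    (∃ V : Set (CyclicProjections.subspaceY M), Dense V ∧ ∀ y₀ ∈ V, ∀ ε : ℝ, 0 < ε →
      CyclicProjections.LimsupInfinite (1 / 2 + ε)
        (fun k => ‖CyclicProjections.traj M (y₀ : H) k -
          CyclicProjections.proj (CyclicProjections.inter M) (y₀ : H)‖) ∧
      CyclicProjections.LimsupInfinite (3 / 2 + ε)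
        (fun k => ‖CyclicProjections.traj M (y₀ : H) k -
          CyclicProjections.traj M (y₀ : H) (k - 1)‖) ∧
      CyclicProjections.LimsupInfinite (1 + ε)
        (fun k => CyclicProjections.avgDist M (CyclicProjections.traj M (y₀ : H) k))) := by
  constructor
  · refine ⟨_, dense_not_polyBdd (p := 0) (A := fun k => cyclicOp M ^ k - proj (inter M))
      fun ε hε => by simpa using exists_not_polyBdd M hM hε, fun y hy ε hε => ⟨?_, ?_⟩⟩
    · by_contra h
      refine hy ε hε ?_
      rw [zero_add]
      exact PolyBdd.traj_of_displacement M hε (polyBdd_of_not_limsupInfinite h)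
    · by_contra h
      refine hy ε hε ?_
      rw [zero_add]
      exact PolyBdd.traj_of_avgDist M hε (polyBdd_of_not_limsupInfinite h)
  · refine ⟨_, dense_image_paramY M (dense_not_polyBdd fun ε hε =>
      exists_not_polyBdd_paramY M hM hε), ?_⟩
    rintro y ⟨z, hz, hzy⟩ ε hε
    have hy : ¬ PolyBdd (1 / 2 + ε) fun k => ‖traj M (y : H) k - proj (inter M) (y : H)‖ := by
      rw [← hzy]
      exact hz ε hε
    refine ⟨?_, ?_, ?_⟩ <;> by_contra h <;> refine hy ?_
    · exact polyBdd_of_not_limsupInfinite h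
    · refine PolyBdd.traj_of_displacement M (by positivity) ?_
      rw [show 1 + (1 / 2 + ε) = 3 / 2 + ε by ring]
      exact polyBdd_of_not_limsupInfinite h
    · refine PolyBdd.traj_of_avgDist M (by positivity) ?_
      rw [show 1 / 2 + (1 / 2 + ε) = 1 + ε by ring]
      exact polyBdd_of_not_limsupInfinite h
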